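/- For a finite connected graph $G=(V,E)$ let $(J_e)_{e\in E}$ be i.i.d. standard Gaussian couplings, and let $\sigma\in\{-1,+1\}^V$ be a ground state, i.e. a maximizer of $H(\sigma)=\sum_{e=\{x,y\}\in E}J_e\sigma_x\sigma_y$; almost surely $\sigma$ is unique up to a global sign, so for $u,v\in V$ the product $\sigma_u\sigma_v$ is almost surely a well-defined function of $J$. Let $h_k$ ($k\ge 0$) be the Hermite polynomials, normalized to be orthonormal with respect to the standard Gaussian measure on $\mathbb{R}$. For $\mathbf{k}\in\{0,1,2,\dots\}^E$ put $\alpha_{\mathbf{k}}=\mathbb{E}\big[\sigma_u\sigma_v\prod_{e\in E}h_{k_e}(J_e)\big]$, and for $S\subseteq E$ define the spectral mass $\mu(S)=\sum_{\mathbf{k}:\,\{e\in E:\,k_e\ge 1\}=S}\alpha_{\mathbf{k}}^2$. There exists a constant $c>0$ such that the following holds for every even integer $n\ge 2$. Let $G$ be the grid $\{(i,j)\in\mathbb{Z}^2: 1\le i,j\le n\}$ with nearest neighbor edges, let $u=(1,n/2)$ and $v=(n,n/2)$, and let $\mu$ be the spectral mass for $\sigma_u\sigma_v$. Let $\mathcal{L}$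 be the set of edges $\{(k,n/2),(k+1,n/2)\}$, $1\le k<n$, and let $\widehat{\mathcal{L}}$ be the set consisting of $\mathcal{L}$ and all edges that share a vertex with some edge of $\mathcal{L}$. Then $$\sum_{\mathcal{L}\subseteq S\subseteq\widehat{\mathcal{L}}}\mu(S)\;\ge\; e^{-cn\log n},$$ and there is a set $S$ with $\mathcal{L}\subseteq S\subseteq\widehat{\mathcal{L}}$ and $\mu(S)\ge e^{-cn\log n}$. -/

import Mathlib

open MeasureTheory ProbabilityTheory
open scoped Nat

noncomputable section

namespace EdwardsAnderson

section GeneralGraph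

variable {V : Type*} (G : SimpleGraph V)

/-- A realization of the couplings: one real number `J e` for each edge `e` of `G`. -/
abbrev Coupling : Type _ := G.edgeSet → ℝ

/-- Spin configurations `σ ∈ {-1, +1}^V`. -/
abbrev SpinConfig (V : Type*) : Type _ := V → ℤˣ

/-- The product `σ_x σ_y` of the spins at the two ends of `e = {x, y}`. -/
def edgeSpin (σ : SpinConfig V) (e : Sym2 V) : ℝ :=
  Sym2.lift ⟨fun x y => (((σ x * σ y : ℤˣ) : ℤ) : ℝ), fun x y => by simp only [mul_comm]⟩ e

/-- The Hamiltonian `H(σ) = ∑_{e = {x, y}} J_e σ_x σ_y`. -/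
def hamiltonian [Fintype G.edgeSet] (J : Coupling G) (σ : SpinConfig V) : ℝ :=
  ∑ e : G.edgeSet, J e * edgeSpin σ e

/-- A ground state is a maximizer of the Hamiltonian. -/
def IsGroundState [Fintype G.edgeSet] (J : Coupling G) (σ : SpinConfig V) : Prop :=
  ∀ τ : SpinConfig V, hamiltonian G J τ ≤ hamiltonian G J σ

theorem exists_isGroundState [Finite V] [Fintype G.edgeSet] (J : Coupling G) :
    ∃ σ : SpinConfig V, IsGroundState G J σ :=
  Finite.exists_max (hamiltonian G J)

/-- A ground state for the couplings `J`. On a connected graph it is unique up to a global sign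
for almost every `J`, so that the choice affects the relative spins only on a null set. -/
def groundState [Finite V] [Fintype G.edgeSet] (J : Coupling G) : SpinConfig V :=
  Classical.choose (exists_isGroundState G J)

/-- The relative spin `σ_u σ_v` of the ground state, as a function of the couplings. -/
def relSpin [Finite V] [Fintype G.edgeSet] (u v : V) (J : Coupling G) : ℝ :=
  ((groundState G J u * groundState G J v : ℤˣ) : ℤ)

/-- The law of the couplings: independent standard Gaussians. -/
def couplingLaw [Fintype G.edgeSet] : Measure (Coupling G) :=
  Measure.pi fun _ => gaussianReal 0 1

/-- The Hermite polynomial of degree `k`, normalized to be orthonormal for the standard Gaussian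
(`Polynomial.hermite k` is the monic one, whose second moment is `k!`). -/
def hermiteFn (k : ℕ) (x : ℝ) : ℝ :=
  Polynomial.aeval x (Polynomial.hermite k) / √(k ! : ℝ)

/-- The basis function `h_𝐤(J) = ∏_e h_{k_e}(J_e)`. -/
def hermiteProd [Fintype G.edgeSet] (k : G.edgeSet → ℕ) (J : Coupling G) : ℝ :=
  ∏ e : G.edgeSet, hermiteFn (k e) (J e)

/-- The Fourier coefficient `α_𝐤 = 𝔼[σ_u σ_v h_𝐤(J)]`. -/
def fourierCoeff [Finite V] [Fintype G.edgeSet] (u v : V) (k : G.edgeSet → ℕ) : ℝ :=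
  ∫ J, relSpin G u v J * hermiteProd G k J ∂(couplingLaw G)

/-- The support `E_𝐤 = {e : k_e ≥ 1}`. -/
def multiSupport [Fintype G.edgeSet] (k : G.edgeSet → ℕ) : Finset G.edgeSet :=
  Finset.univ.filter fun e => 1 ≤ k e

/-- The spectral mass `μ(S) = ∑_{𝐤 : E_𝐤 = S} α_𝐤²` of a set `S` of edges. -/
def spectralMass [Finite V] [Fintype G.edgeSet] (u v : V) (S : Finset G.edgeSet) : ℝ :=
  ∑' k : {k : G.edgeSet → ℕ // multiSupport G k = S}, fourierCoeff G u v k.1 ^ 2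

end GeneralGraph

section Grid

/-- The vertices `(i, j) ∈ ℤ²` with `1 ≤ i, j ≤ n`. -/
abbrev GridVertex (n : ℕ) : Type :=
  ↥(Finset.Icc (1 : ℤ) n ×ˢ Finset.Icc (1 : ℤ) n)

/-- The `n × n` grid with nearest neighbour edges (Manhattan distance one). -/
def grid (n : ℕ) : SimpleGraph (GridVertex n) where
  Adj x y := |x.1.1 - y.1.1| + |x.1.2 - y.1.2| = 1
  symm := ⟨fun x y h => by rw [abs_sub_comm y.1.1, abs_sub_comm y.1.2]; exact h⟩
  loopless := ⟨fun x h => by simp at h⟩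

instance (n : ℕ) : Fintype (grid n).edgeSet := Fintype.ofFinite _

/-- `u = (1, n/2)`. -/
def leftEnd (n : ℕ) (hn : 2 ≤ n) : GridVertex n :=
  ⟨(1, (n : ℤ) / 2), by simp only [Finset.mem_product, Finset.mem_Icc]; omega⟩

/-- `v = (n, n/2)`. -/
def rightEnd (n : ℕ) (hn : 2 ≤ n) : GridVertex n :=
  ⟨((n : ℤ), (n : ℤ) / 2), by simp only [Finset.mem_product, Finset.mem_Icc]; omega⟩

open Classical in
/-- The horizontal line `ℒ`: the edges `{(k, n/2), (k+1, n/2)}` with `1 ≤ k < n`. -/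
def line (n : ℕ) : Finset (grid n).edgeSet :=
  Finset.univ.filter fun e => ∃ k : ℤ, 1 ≤ k ∧ k < n ∧
    Sym2.map Subtype.val e.1 = s((k, (n : ℤ) / 2), (k + 1, (n : ℤ) / 2))

open Classical in
/-- `ℒ̂`: the edges of `ℒ` and all edges which share a vertex with an edge of `ℒ`. -/
def lineHat (n : ℕ) : Finset (grid n).edgeSet :=
  line n ∪ Finset.univ.filter fun e => ∃ f ∈ line n, ∃ w : GridVertex n, w ∈ e.1 ∧ w ∈ f.1

end Grid

end EdwardsAnderson

end

/-!
A test function against which `σ_u σ_v` has a large correlation is `f = ∏_e f_e(J_e)`, where `f_e`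
is the sign of `J_e` cut off to `|J_e| > 1` for `e ∈ ℒ`, the indicator of `|J_e| ≤ ε` for
`e ∈ ℒ̂ \ ℒ`, and `1` elsewhere, with `ε · #(ℒ̂ \ ℒ) ≤ 1`. Where `f ≠ 0`, each edge of `ℒ` outweighs
the other edges of a cut inside `ℒ̂`. Flipping the ground state on one side of that cut would
otherwise increase the Hamiltonian, so the edge is satisfied. Hence `σ_u σ_v` is the product of the
signs of the couplings along `ℒ`, and `𝔼[σ_u σ_v f] = 𝔼[f²]`.

As `f_e` is centred for `e ∈ ℒ` and constant for `e ∉ ℒ̂`, only `𝐤` with `ℒ ⊆ E_𝐤 ⊆ ℒ̂` occur in the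
Hermite expansion of `f`. By Cauchy-Schwarz, `∑ μ(S) ≥ 𝔼[f²]` over these sets, and `𝔼[f²]` is a
product of at most `4n` factors of order `1` or `ε = 1 / (4n)`. There are only `2 ^ #(ℒ̂ \ ℒ)` such
sets, which is absorbed in the constant when passing from the sum to a single one.
-/

noncomputable section

namespace EdwardsAnderson

open Polynomial Filter
open scoped Finset Topology NNReal

local notation "γ" => gaussianReal 0 1

section Moments

theorem eventuallyEq_of_iteratedDeriv_eq {𝕜 E : Type*} [NontriviallyNormedField 𝕜] [CharZero 𝕜]
    [CompleteSpace 𝕜] [NormedAddCommGroup E] [NormedSpace 𝕜 E] [CompleteSpace E] {f g : 𝕜 → E}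
    {z : 𝕜} (hf : AnalyticAt 𝕜 f z) (hg : AnalyticAt 𝕜 g z)
    (h : ∀ n, iteratedDeriv n f z = iteratedDeriv n g z) : f =ᶠ[𝓝 z] g := by
  have horder : analyticOrderAt (f - g) z = ⊤ := ENat.eq_top_iff_forall_ge.2 fun n =>
    (natCast_le_analyticOrderAt_iff_iteratedDeriv_eq_zero (hf.sub hg)).2 fun i _ => by
      rw [iteratedDeriv_sub hf.contDiffAt hg.contDiffAt, h, sub_self]
  filter_upwards [analyticOrderAt_eq_top.1 horder] with w hw using sub_eq_zero.1 hw

theorem measure_ext_of_forall_integral_pow_eq {μ ν : Measure ℝ} [IsFiniteMeasure μ]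
    [IsFiniteMeasure ν] (hμ : 0 ∈ interior (integrableExpSet id μ))
    (hν : 0 ∈ interior (integrableExpSet id ν))
    (h : ∀ n : ℕ, ∫ x, x ^ n ∂μ = ∫ x, x ^ n ∂ν) : μ = ν := by
  set U : Set ℂ := {z | z.re ∈ interior (integrableExpSet id μ) ∩ interior (integrableExpSet id ν)}
  have hU : IsPreconnected U := ((convex_integrableExpSet.interior.inter
    convex_integrableExpSet.interior).linear_preimage Complex.reLm).isPreconnected
  have hlocal : complexMGF id μ =ᶠ[𝓝 0] complexMGF id ν := by
    refine eventuallyEq_of_iteratedDeriv_eq (analyticAt_complexMGF hμ) (analyticAt_complexMGF hν)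
      fun n => ?_
    rw [iteratedDeriv_complexMGF hμ, iteratedDeriv_complexMGF hν]
    simpa [← Complex.ofReal_pow, integral_complex_ofReal] using h n
  have hstrip : Set.EqOn (complexMGF id μ) (complexMGF id ν) U :=
    (analyticOnNhd_complexMGF.mono fun _ hz => hz.1).eqOn_of_preconnected_of_eventuallyEq
      (analyticOnNhd_complexMGF.mono fun _ hz => hz.2) hU ⟨hμ, hν⟩ hlocal
  refine Measure.ext_of_charFun (funext fun t => ?_)
  rw [← complexMGF_id_mul_I, ← complexMGF_id_mul_I]
  exact hstrip (by simpa [U] using And.intro hμ hν)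

variable {μ : Measure ℝ} {g : ℝ → ℝ}

theorem mem_integrableExpSet_withDensity {t : ℝ} (hg : MemLp g 2 μ)
    (ht : 2 * t ∈ integrableExpSet id μ) :
    t ∈ integrableExpSet id (μ.withDensity fun x => ENNReal.ofReal (g x)) := by
  have hexp : MemLp (fun x => Real.exp (t * x)) 2 μ := by
    rw [memLp_two_iff_integrable_sq (by fun_prop)]
    refine Integrable.congr ht (ae_of_all _ fun x => ?_)
    simp only [id, ← Real.exp_nat_mul, Nat.cast_ofNat, mul_assoc]
  refine (integrable_withDensity_iff_integrable_smul₀' hg.1.aemeasurable.ennreal_ofReal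
    (ae_of_all _ fun _ => ENNReal.ofReal_lt_top)).2 ?_
  simp only [ENNReal.toReal_ofReal', smul_eq_mul]
  exact hg.pos_part.integrable_mul hexp

theorem zero_mem_interior_integrableExpSet_withDensity (hg : MemLp g 2 μ)
    (hμ : 0 ∈ interior (integrableExpSet id μ)) :
    0 ∈ interior (integrableExpSet id (μ.withDensity fun x => ENNReal.ofReal (g x))) := by
  have htwo_mul : Tendsto (fun t : ℝ => 2 * t) (𝓝 0) (𝓝 0) := by
    simpa using (continuous_const_mul (2 : ℝ)).tendsto 0
  rw [mem_interior_iff_mem_nhds] at hμ ⊢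
  filter_upwards [htwo_mul hμ] with t ht using mem_integrableExpSet_withDensity hg ht

-- The positive and the negative part of `g` are densities of measures with the same moments.
theorem ae_eq_zero_of_forall_integral_mul_pow_eq_zero [IsFiniteMeasure μ]
    (hμ : 0 ∈ interior (integrableExpSet id μ)) (hg : MemLp g 2 μ)
    (h : ∀ n : ℕ, ∫ x, g x * x ^ n ∂μ = 0) : g =ᵐ[μ] 0 := by
  have := isFiniteMeasure_withDensity_ofReal (hg.integrable one_le_two).2
  have := isFiniteMeasure_withDensity_ofReal (hg.neg.integrable one_le_two).2
  have hpow (n : ℕ) : MemLp (fun x : ℝ => x ^ n) 2 μ := by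
    rw [memLp_two_iff_integrable_sq (by fun_prop)]
    simpa only [← pow_mul, id] using
      integrable_pow_of_mem_interior_integrableExpSet hμ (n * 2)
  have hint {f : ℝ → ℝ} (hf : MemLp f 2 μ) (n : ℕ) :
      Integrable (fun x => max (f x) 0 * x ^ n) μ := hf.pos_part.integrable_mul (hpow n)
  have hmoment {f : ℝ → ℝ} (hf : MemLp f 2 μ) (n : ℕ) :
      ∫ x, x ^ n ∂μ.withDensity (fun x => ENNReal.ofReal (f x)) = ∫ x, max (f x) 0 * x ^ n ∂μ := by
    rw [integral_withDensity_eq_integral_toReal_smul₀ hf.1.aemeasurable.ennreal_ofReal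
      (ae_of_all _ fun _ => ENNReal.ofReal_lt_top)]
    simp only [ENNReal.toReal_ofReal', smul_eq_mul]
  have hdensity : (μ.withDensity fun x => ENNReal.ofReal (g x))
      = μ.withDensity fun x => ENNReal.ofReal ((-g) x) := by
    refine measure_ext_of_forall_integral_pow_eq
      (zero_mem_interior_integrableExpSet_withDensity hg hμ)
      (zero_mem_interior_integrableExpSet_withDensity hg.neg hμ) fun n => ?_
    rw [hmoment hg, hmoment hg.neg, ← sub_eq_zero, ← integral_sub (hint hg n) (hint hg.neg n)]
    simpa only [← sub_mul, Pi.neg_apply, max_zero_sub_max_neg_zero_eq_self] using h n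
  filter_upwards [(withDensity_eq_iff_of_sigmaFinite hg.1.aemeasurable.ennreal_ofReal
    hg.neg.1.aemeasurable.ennreal_ofReal).1 hdensity] with x hx
  have hparts := congrArg ENNReal.toReal hx
  rw [ENNReal.toReal_ofReal', ENNReal.toReal_ofReal', Pi.neg_apply] at hparts
  rw [← max_zero_sub_max_neg_zero_eq_self (g x), hparts, sub_self, Pi.zero_apply]

end Moments

section Stein

theorem hasDerivAt_gaussianPDFReal (m : ℝ) (v : ℝ≥0) (x : ℝ) :
    HasDerivAt (gaussianPDFReal m v) (-((x - m) / v * gaussianPDFReal m v x)) x := by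
  have hexponent : HasDerivAt (fun y : ℝ => -(y - m) ^ 2 / (2 * v)) (-((x - m) / v)) x := by
    convert! ((((hasDerivAt_id x).sub_const m).pow 2).neg.div_const (2 * (v : ℝ))) using 1
    simp only [id, Nat.cast_ofNat, mul_one, neg_div, Nat.add_one_sub_one, pow_one]
    rw [mul_div_mul_left _ _ two_ne_zero]
  rw [gaussianPDFReal_def]
  convert! hexponent.exp.const_mul (√(2 * Real.pi * v))⁻¹ using 1
  ring

theorem integrable_gaussianReal_iff {m : ℝ} {v : ℝ≥0} (hv : v ≠ 0) {f : ℝ → ℝ} :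
    Integrable f (gaussianReal m v) ↔ Integrable (fun x => f x * gaussianPDFReal m v x) := by
  rw [gaussianReal_of_var_ne_zero m hv, integrable_withDensity_iff_integrable_smul'
    (measurable_gaussianPDF m v) (ae_of_all _ fun _ => gaussianPDF_lt_top)]
  simp only [toReal_gaussianPDF, smul_eq_mul, mul_comm]

theorem integral_sub_mul_gaussianReal {m : ℝ} {v : ℝ≥0} {f f' : ℝ → ℝ}
    (hderiv : ∀ x, HasDerivAt f (f' x) x) (hf : Integrable f (gaussianReal m v))
    (hf' : Integrable f' (gaussianReal m v))
    (hxf : Integrable (fun x => (x - m) * f x) (gaussianReal m v)) :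
    ∫ x, (x - m) * f x ∂gaussianReal m v = v * ∫ x, f' x ∂gaussianReal m v := by
  rcases eq_or_ne v 0 with rfl | hv
  · simp only [gaussianReal_zero_var, integral_dirac, sub_self, zero_mul, NNReal.coe_zero]
  have hv' : (v : ℝ) ≠ 0 := NNReal.coe_ne_zero.2 hv
  rw [integrable_gaussianReal_iff hv] at hf hf' hxf
  have hparts := integral_mul_deriv_eq_deriv_mul_of_integrable
    (fun x _ => hderiv x) (fun x _ => hasDerivAt_gaussianPDFReal m v x)
    ((hxf.const_mul (-(v : ℝ)⁻¹)).congr (ae_of_all _ fun x => by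
      simp only [Pi.mul_apply]; ring)) hf' hf
  rw [integral_gaussianReal_eq_integral_smul hv, integral_gaussianReal_eq_integral_smul hv]
  calc ∫ x, gaussianPDFReal m v x • ((x - m) * f x)
      = ∫ x, -(v : ℝ) * (f x * -((x - m) / v * gaussianPDFReal m v x)) := by
        congr with x
        rw [smul_eq_mul]
        field_simp
    _ = v * ∫ x, gaussianPDFReal m v x • f' x := by
        rw [integral_const_mul, hparts, neg_mul_neg]
        simp only [smul_eq_mul, mul_comm]

end Stein

section Hermite

/-- The monic probabilists' Hermite polynomials with real coefficients, as a sequence of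
polynomials indexed by their degree. -/
def realHermite : Polynomial.Sequence ℝ where
  elems' n := (hermite n).map (Int.castRingHom ℝ)
  degree_eq' n := by rw [(hermite_monic n).degree_map, degree_hermite]

theorem realHermite_zero : realHermite 0 = 1 := by
  change (hermite 0).map _ = 1
  rw [hermite_zero, C_1, Polynomial.map_one]

theorem realHermite_succ (n : ℕ) :
    realHermite (n + 1) = X * realHermite n - derivative (realHermite n) := by
  change (hermite (n + 1)).map _ = X * (hermite n).map _ - derivative ((hermite n).map _)
  rw [hermite_succ, Polynomial.map_sub, Polynomial.map_mul, map_X, derivative_map]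

theorem monic_realHermite (n : ℕ) : (realHermite n).Monic := (hermite_monic n).map _

theorem hermiteFn_eq (k : ℕ) (x : ℝ) : hermiteFn k x = (realHermite k).eval x / √(k ! : ℝ) := by
  rw [hermiteFn, aeval_def, eval₂_eq_eval_map]
  rfl

theorem hermiteFn_zero (x : ℝ) : hermiteFn 0 x = 1 := by
  simp only [hermiteFn_eq, realHermite_zero, eval_one, Nat.factorial_zero, Nat.cast_one,
    Real.sqrt_one, div_one]

theorem zero_mem_interior_integrableExpSet_gaussianReal (m : ℝ) (v : ℝ≥0) :
    0 ∈ interior (integrableExpSet id (gaussianReal m v)) := by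
  rw [integrableExpSet_id_gaussianReal, interior_univ]
  exact Set.mem_univ 0

theorem integrable_eval_gaussianReal (m : ℝ) (v : ℝ≥0) (p : ℝ[X]) :
    Integrable (fun x => p.eval x) (gaussianReal m v) := by
  simp_rw [eval_eq_sum_range]
  exact integrable_finsetSum _ fun i _ => (integrable_pow_of_mem_interior_integrableExpSet
    (zero_mem_interior_integrableExpSet_gaussianReal m v) i).const_mul _

theorem memLp_eval_gaussianReal (m : ℝ) (v : ℝ≥0) (p : ℝ[X]) :
    MemLp (fun x => p.eval x) 2 (gaussianReal m v) := by
  rw [memLp_two_iff_integrable_sq p.continuous.aestronglyMeasurable]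
  simp_rw [← eval_pow]
  exact integrable_eval_gaussianReal m v (p ^ 2)

theorem memLp_hermiteFn (k : ℕ) : MemLp (hermiteFn k) 2 γ := by
  have hfun : hermiteFn k = fun x => (√(k ! : ℝ))⁻¹ * (realHermite k).eval x := by
    ext x
    rw [hermiteFn_eq, div_eq_inv_mul]
  rw [hfun]
  exact (memLp_eval_gaussianReal 0 1 _).const_mul _

theorem integral_X_mul_eval (p : ℝ[X]) :
    ∫ x, (X * p).eval x ∂γ = ∫ x, (derivative p).eval x ∂γ := by
  have hX (x : ℝ) : (X * p).eval x = (x - 0) * p.eval x := by rw [eval_mul, eval_X, sub_zero]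
  have hstein := integral_sub_mul_gaussianReal (m := 0) (v := 1) (fun x => p.hasDerivAt x)
    (integrable_eval_gaussianReal 0 1 p) (integrable_eval_gaussianReal 0 1 (derivative p))
    (by simpa only [← hX] using integrable_eval_gaussianReal 0 1 (X * p))
  simpa only [hX, NNReal.coe_one, one_mul] using hstein

theorem integral_realHermite_mul (n : ℕ) (q : ℝ[X]) :
    ∫ x, (realHermite n * q).eval x ∂γ = ∫ x, (derivative^[n] q).eval x ∂γ := by
  induction n generalizing q with
  | zero => rw [realHermite_zero, one_mul, Function.iterate_zero_apply]
  | succ n ih =>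
    have hstein := integral_X_mul_eval (realHermite n * q)
    have hderivative : realHermite n * derivative q
        = derivative (realHermite n * q) - derivative (realHermite n) * q := by
      rw [derivative_mul, add_sub_cancel_left]
    rw [Function.iterate_succ_apply, ← ih, realHermite_succ, sub_mul, mul_assoc, hderivative]
    simp_rw [eval_sub]
    rw [integral_sub, integral_sub, hstein] <;> exact integrable_eval_gaussianReal 0 1 _

theorem integral_realHermite_mul_of_lt {m n : ℕ} (h : m < n) :
    ∫ x, (realHermite n * realHermite m).eval x ∂γ = 0 := by
  rw [integral_realHermite_mul, iterate_derivative_eq_zero (by rwa [realHermite.natDegree_eq])]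
  simp only [eval_zero, integral_zero]

theorem iterate_derivative_natDegree {R : Type*} [CommSemiring R] (p : R[X]) :
    derivative^[p.natDegree] p = C (p.natDegree ! * p.leadingCoeff) := by
  ext i
  rw [coeff_iterate_derivative, coeff_C]
  split_ifs with hi
  · rw [hi, zero_add, Nat.descFactorial_self, nsmul_eq_mul, leadingCoeff]
  · rw [coeff_eq_zero_of_natDegree_lt (by omega), smul_zero]

theorem integral_realHermite_mul_self (n : ℕ) :
    ∫ x, (realHermite n * realHermite n).eval x ∂γ = n ! := by
  have hiterate : derivative^[n] (realHermite n) = C (n ! : ℝ) := by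
    simpa only [realHermite.natDegree_eq, (monic_realHermite n).leadingCoeff, mul_one] using
      iterate_derivative_natDegree (realHermite n)
  simp only [integral_realHermite_mul, hiterate, eval_C, integral_const, probReal_univ, one_smul]

theorem integral_hermiteFn_mul_hermiteFn (j k : ℕ) :
    ∫ x, hermiteFn j x * hermiteFn k x ∂γ = if j = k then 1 else 0 := by
  simp_rw [hermiteFn_eq, div_mul_div_comm, ← eval_mul, integral_div]
  rcases lt_trichotomy j k with h | rfl | h
  · rw [mul_comm (realHermite j), integral_realHermite_mul_of_lt h, zero_div, if_neg h.ne]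
  · rw [integral_realHermite_mul_self, Real.mul_self_sqrt (Nat.cast_nonneg _), if_pos rfl,
      div_self (Nat.cast_ne_zero.2 j.factorial_ne_zero)]
  · rw [integral_realHermite_mul_of_lt h, zero_div, if_neg h.ne']

theorem integral_mul_eval_eq_zero {g : ℝ → ℝ} (hg : MemLp g 2 γ)
    (h : ∀ k, ∫ x, g x * hermiteFn k x ∂γ = 0) (p : ℝ[X]) : ∫ x, g x * p.eval x ∂γ = 0 := by
  have hp : p ∈ Submodule.span ℝ (Set.range realHermite) := by
    rw [realHermite.span fun n => by rw [(monic_realHermite n).leadingCoeff]; exact isUnit_one]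
    trivial
  have hint (q : ℝ[X]) : Integrable (fun x => g x * q.eval x) γ :=
    hg.integrable_mul (memLp_eval_gaussianReal 0 1 q)
  induction hp using Submodule.span_induction with
  | mem p hp =>
    obtain ⟨k, rfl⟩ := hp
    have hk : √(k ! : ℝ) ≠ 0 := by positivity
    simpa only [hermiteFn_eq, ← mul_div_assoc, integral_div, div_eq_zero_iff, hk, or_false]
      using h k
  | zero => simp only [eval_zero, mul_zero, integral_zero]
  | add p q _ _ ihp ihq =>
    simp_rw [eval_add, mul_add]
    rw [integral_add (hint p) (hint q), ihp, ihq, add_zero]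
  | smul c p _ ih =>
    simp_rw [eval_smul, smul_eq_mul, mul_left_comm (g _) c]
    rw [integral_const_mul, ih, mul_zero]

theorem ae_eq_zero_of_forall_integral_mul_hermiteFn_eq_zero {g : ℝ → ℝ} (hg : MemLp g 2 γ)
    (h : ∀ k, ∫ x, g x * hermiteFn k x ∂γ = 0) : g =ᵐ[γ] 0 :=
  ae_eq_zero_of_forall_integral_mul_pow_eq_zero
    (zero_mem_interior_integrableExpSet_gaussianReal 0 1) hg fun n => by
      simpa only [eval_pow, eval_X] using integral_mul_eval_eq_zero hg h (X ^ n)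

theorem inner_toLp {α : Type*} [MeasurableSpace α] {μ : Measure α} {f g : α → ℝ}
    (hf : MemLp f 2 μ) (hg : MemLp g 2 μ) :
    inner ℝ (hf.toLp f) (hg.toLp g) = ∫ x, f x * g x ∂μ := by
  rw [L2.inner_def]
  refine integral_congr_ae ?_
  filter_upwards [hf.coeFn_toLp, hg.coeFn_toLp] with x hfx hgx
  rw [hfx, hgx, RCLike.inner_apply, conj_trivial, mul_comm]

theorem orthonormal_hermiteFn :
    Orthonormal ℝ fun k => (memLp_hermiteFn k).toLp (hermiteFn k) := by
  rw [orthonormal_iff_ite]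
  intro j k
  rw [inner_toLp, integral_hermiteFn_mul_hermiteFn]

/-- The normalized Hermite polynomials as a Hilbert basis of `L²` of the standard Gaussian. -/
def hermiteBasis : HilbertBasis ℕ ℝ (Lp ℝ 2 γ) :=
  HilbertBasis.mkOfOrthogonalEqBot orthonormal_hermiteFn <| by
    refine (Submodule.eq_bot_iff _).2 fun g hg => Lp.eq_zero_iff_ae_eq_zero.2 <|
      ae_eq_zero_of_forall_integral_mul_hermiteFn_eq_zero (Lp.memLp g) fun k => ?_
    rw [← inner_toLp (Lp.memLp g) (memLp_hermiteFn k), Lp.toLp_coeFn, real_inner_comm]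
    exact (Submodule.mem_orthogonal _ _).1 hg _ (Submodule.subset_span ⟨k, rfl⟩)

theorem hermiteBasis_apply (k : ℕ) : hermiteBasis k = (memLp_hermiteFn k).toLp (hermiteFn k) := by
  rw [hermiteBasis, HilbertBasis.coe_mkOfOrthogonalEqBot]

end Hermite

section HilbertSpace

variable {H κ : Type*} [NormedAddCommGroup H] [InnerProductSpace ℝ H] {w : κ → H} {x y : H}

theorem norm_sub_sum_inner_smul_sq (hw : Orthonormal ℝ w) (y : H) (s : Finset κ) :
    ‖y - ∑ k ∈ s, inner ℝ (w k) y • w k‖ ^ 2 = ‖y‖ ^ 2 - ∑ k ∈ s, inner ℝ (w k) y ^ 2 := by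
  have hcross : inner ℝ y (∑ k ∈ s, inner ℝ (w k) y • w k) = ∑ k ∈ s, inner ℝ (w k) y ^ 2 := by
    simp only [inner_sum, real_inner_smul_right, real_inner_comm, sq]
  have hnorm : ‖∑ k ∈ s, inner ℝ (w k) y • w k‖ ^ 2 = ∑ k ∈ s, inner ℝ (w k) y ^ 2 := by
    rw [← real_inner_self_eq_norm_sq, hw.inner_sum]
    simp only [conj_trivial, sq]
  rw [norm_sub_sq_real, hcross, hnorm]
  ring

theorem hasSum_inner_smul_of_hasSum_sq_inner (hw : Orthonormal ℝ w)
    (hy : HasSum (fun k => inner ℝ (w k) y ^ 2) (‖y‖ ^ 2)) :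
    HasSum (fun k => inner ℝ (w k) y • w k) y := by
  have hsq : Tendsto (fun s : Finset κ => ‖y - ∑ k ∈ s, inner ℝ (w k) y • w k‖ ^ 2) atTop
      (𝓝 0) := by
    simp_rw [norm_sub_sum_inner_smul_sq hw]
    rw [← sub_self (‖y‖ ^ 2)]
    exact tendsto_const_nhds.sub hy
  rw [HasSum, SummationFilter.unconditional_filter, tendsto_iff_norm_sub_tendsto_zero]
  simpa only [Real.sqrt_sq (norm_nonneg _), Real.sqrt_zero, norm_sub_rev] using hsq.sqrt

theorem sq_inner_le_norm_sq_mul_tsum (hw : Orthonormal ℝ w)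
    (hy : HasSum (fun k => inner ℝ (w k) y ^ 2) (‖y‖ ^ 2)) (x : H) :
    inner ℝ x y ^ 2 ≤ ‖y‖ ^ 2 * ∑' k, inner ℝ (w k) x ^ 2 := by
  have hinner : HasSum (fun k => inner ℝ (w k) y * inner ℝ (w k) x) (inner ℝ x y) := by
    simpa only [innerSL_apply_apply, real_inner_smul_right, real_inner_comm] using
      (hasSum_inner_smul_of_hasSum_sq_inner hw hy).mapL (innerSL ℝ x)
  have hsummable : Summable fun k => inner ℝ (w k) x ^ 2 := by
    simpa only [Real.norm_eq_abs, sq_abs] using hw.inner_products_summable x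
  exact le_of_tendsto_of_tendsto' (hinner.pow 2) (Tendsto.mul hy hsummable.hasSum) fun s =>
    Finset.sum_mul_sq_le_sq_mul_sq s _ _

theorem sq_inner_le_norm_sq_mul_tsum_subtype (hw : Orthonormal ℝ w)
    (hy : HasSum (fun k => inner ℝ (w k) y ^ 2) (‖y‖ ^ 2)) {T : Set κ}
    (hT : ∀ k ∉ T, inner ℝ (w k) y = 0) (x : H) :
    inner ℝ x y ^ 2 ≤ ‖y‖ ^ 2 * ∑' k : T, inner ℝ (w k) x ^ 2 := by
  refine sq_inner_le_norm_sq_mul_tsum (hw.comp _ Subtype.val_injective) ?_ x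
  refine (hasSum_subtype_iff_of_support_subset fun k hk => ?_).2 hy
  by_contra hkT
  exact hk (by simp only [hT k hkT, ne_eq, OfNat.ofNat_ne_zero, not_false_eq_true, zero_pow])

end HilbertSpace

section ProductSpace

variable {ι : Type*} [Fintype ι]

theorem hasSum_fintype_prod {κ : ι → Type*} {f : ∀ i, κ i → ℝ} {a : ι → ℝ}
    (hf_nonneg : ∀ i k, 0 ≤ f i k) (hf : ∀ i, HasSum (f i) (a i)) :
    HasSum (fun k : ∀ i, κ i => ∏ i, f i (k i)) (∏ i, a i) := by
  classical
  have hbox (t : ∀ i, Finset (κ i)) :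
      ∑ k ∈ Fintype.piFinset t, ∏ i, f i (k i) = ∏ i, ∑ k ∈ t i, f i k :=
    (Finset.prod_univ_sum _ _).symm
  have hsubset (s : Finset (∀ i, κ i)) :
      s ⊆ Fintype.piFinset fun i => s.image fun k => k i := fun k hk =>
    Fintype.mem_piFinset.2 fun i => Finset.mem_image_of_mem _ hk
  have hnonneg (k : ∀ i, κ i) : 0 ≤ ∏ i, f i (k i) :=
    Finset.prod_nonneg fun i _ => hf_nonneg i (k i)
  have hsummable : Summable fun k : ∀ i, κ i => ∏ i, f i (k i) :=
    summable_of_sum_le hnonneg fun s => calc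
      ∑ k ∈ s, ∏ i, f i (k i) ≤ ∏ i, ∑ k ∈ s.image (fun k => k i), f i k := by
        rw [← hbox]
        exact Finset.sum_le_sum_of_subset_of_nonneg (hsubset s) fun k _ _ => hnonneg k
      _ ≤ ∏ i, a i := Finset.prod_le_prod (fun i _ => Finset.sum_nonneg fun k _ => hf_nonneg i k)
        fun i _ => sum_le_hasSum _ (fun k _ => hf_nonneg i k) (hf i)
  have hboxes : Tendsto (fun t : ∀ i, Finset (κ i) => Fintype.piFinset t) atTop atTop :=
    tendsto_atTop_finset_of_monotone (fun s t hst => Fintype.piFinset_subset s t hst)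
      fun k => ⟨fun i => {k i}, Fintype.mem_piFinset.2 fun i => Finset.mem_singleton_self _⟩
  have hcoord (i : ι) : Tendsto (fun t : ∀ i, Finset (κ i) => t i) atTop atTop :=
    tendsto_atTop_atTop_of_monotone (Function.monotone_eval i) fun b =>
      ⟨Function.update (fun _ => ∅) i b, by rw [Function.update_self]⟩
  have hlim := hsummable.hasSum.comp hboxes
  simp only [Function.comp_def, hbox] at hlim
  rw [tendsto_nhds_unique (tendsto_finsetProd _ fun i _ => (hf i).comp (hcoord i)) hlim]
  exact hsummable.hasSum

variable {E : ι → Type*} [∀ i, MeasurableSpace (E i)] {μ : ∀ i, Measure (E i)}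
  [∀ i, SigmaFinite (μ i)] {f g : ∀ i, E i → ℝ}

theorem memLp_fintype_prod (hf : ∀ i, MemLp (f i) 2 (μ i)) :
    MemLp (fun x : ∀ i, E i => ∏ i, f i (x i)) 2 (Measure.pi μ) := by
  have hmeas : AEStronglyMeasurable (fun x : ∀ i, E i => ∏ i, f i (x i)) (Measure.pi μ) :=
    Finset.aestronglyMeasurable_fun_prod _ fun i _ =>
      (hf i).1.comp_quasiMeasurePreserving (Measure.quasiMeasurePreserving_eval μ i)
  rw [memLp_two_iff_integrable_sq hmeas]
  simp_rw [← Finset.prod_pow]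
  exact Integrable.fintype_prod_dep fun i => (hf i).integrable_sq

theorem inner_toLp_fintype_prod (hf : ∀ i, MemLp (f i) 2 (μ i)) (hg : ∀ i, MemLp (g i) 2 (μ i)) :
    inner ℝ ((memLp_fintype_prod hf).toLp _) ((memLp_fintype_prod hg).toLp _)
      = ∏ i, ∫ x, f i x * g i x ∂μ i := by
  rw [inner_toLp]
  simp_rw [← Finset.prod_mul_distrib]
  exact integral_fintype_prod_eq_prod fun i x => f i x * g i x

variable {κ : ι → Type*} {b : ∀ i, κ i → E i → ℝ} (hb : ∀ i k, MemLp (b i k) 2 (μ i))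

theorem orthonormal_toLp_fintype_prod
    (horth : ∀ i, Orthonormal ℝ fun k => (hb i k).toLp (b i k)) :
    Orthonormal ℝ fun k : ∀ i, κ i =>
      (memLp_fintype_prod fun i => hb i (k i)).toLp fun x : ∀ i, E i => ∏ i, b i (k i) (x i) := by
  classical
  refine orthonormal_iff_ite.2 fun j k => ?_
  have horth' (i : ι) (k l : κ i) : ∫ x, b i k x * b i l x ∂μ i = if k = l then 1 else 0 := by
    rw [← inner_toLp (hb i k) (hb i l)]
    exact orthonormal_iff_ite.1 (horth i) k l
  rw [inner_toLp_fintype_prod (fun i => hb i (j i)) fun i => hb i (k i)]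
  simp only [horth', Fintype.prod_ite_zero, Finset.prod_const_one, funext_iff]

/- Cauchy-Schwarz, restricted to the part `T` of an orthonormal product family on which the
expansion of the product function lives. -/
theorem sq_integral_mul_fintype_prod_le (hf : ∀ i, MemLp (f i) 2 (μ i))
    (horth : ∀ i, Orthonormal ℝ fun k => (hb i k).toLp (b i k))
    (hparseval : ∀ i, HasSum (fun k => (∫ x, b i k x * f i x ∂μ i) ^ 2) (∫ x, f i x ^ 2 ∂μ i))
    {T : Set (∀ i, κ i)} (hT : ∀ k ∉ T, ∃ i, ∫ x, b i (k i) x * f i x ∂μ i = 0)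
    {F : (∀ i, E i) → ℝ} (hF : MemLp F 2 (Measure.pi μ)) :
    (∫ x, F x * ∏ i, f i (x i) ∂Measure.pi μ) ^ 2 ≤
      (∏ i, ∫ x, f i x ^ 2 ∂μ i) *
        ∑' k : T, (∫ x, F x * ∏ i, b i (k.1 i) (x i) ∂Measure.pi μ) ^ 2 := by
  set y := (memLp_fintype_prod hf).toLp _
  set w : (∀ i, κ i) → Lp ℝ 2 (Measure.pi μ) := fun k =>
    (memLp_fintype_prod fun i => hb i (k i)).toLp _
  have hw : Orthonormal ℝ w := orthonormal_toLp_fintype_prod hb horth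
  have hnorm : ‖y‖ ^ 2 = ∏ i, ∫ x, f i x ^ 2 ∂μ i := by
    simp_rw [← real_inner_self_eq_norm_sq, y, inner_toLp_fintype_prod hf hf, ← sq]
  have hcoeff (k : ∀ i, κ i) : inner ℝ (w k) y = ∏ i, ∫ x, b i (k i) x * f i x ∂μ i :=
    inner_toLp_fintype_prod (fun i => hb i (k i)) hf
  have hexpansion : HasSum (fun k => inner ℝ (w k) y ^ 2) (‖y‖ ^ 2) := by
    simp_rw [hnorm, hcoeff, ← Finset.prod_pow]
    exact hasSum_fintype_prod (f := fun i k => (∫ x, b i k x * f i x ∂μ i) ^ 2)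
      (fun _ _ => sq_nonneg _) hparseval
  have hsupport (k : ∀ i, κ i) (hk : k ∉ T) : inner ℝ (w k) y = 0 := by
    obtain ⟨i, hi⟩ := hT k hk
    rw [hcoeff, Finset.prod_eq_zero (Finset.mem_univ i) hi]
  have hFy : inner ℝ (hF.toLp F) y = ∫ x, F x * ∏ i, f i (x i) ∂Measure.pi μ :=
    inner_toLp hF (memLp_fintype_prod hf)
  have hFw (k : ∀ i, κ i) :
      inner ℝ (w k) (hF.toLp F) = ∫ x, F x * ∏ i, b i (k i) (x i) ∂Measure.pi μ := by
    rw [real_inner_comm]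
    exact inner_toLp hF (memLp_fintype_prod fun i => hb i (k i))
  simp_rw [← hFy, ← hFw, ← hnorm]
  exact sq_inner_le_norm_sq_mul_tsum_subtype hw hexpansion hsupport (hF.toLp F)

end ProductSpace

section SpectralMass

theorem hasSum_sq_integral_hermiteFn_mul {f : ℝ → ℝ} (hf : MemLp f 2 γ) :
    HasSum (fun k => (∫ x, hermiteFn k x * f x ∂γ) ^ 2) (∫ x, f x ^ 2 ∂γ) := by
  have hparseval := hermiteBasis.hasSum_inner_mul_inner (hf.toLp f) (hf.toLp f)
  simpa only [hermiteBasis_apply, inner_toLp, mul_comm (f _) (hermiteFn _ _), ← sq]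
    using hparseval

variable {V : Type*} [Finite V] (G : SimpleGraph V) [Fintype G.edgeSet]

instance : IsProbabilityMeasure (couplingLaw G) := by
  unfold couplingLaw
  infer_instance

-- `relSpin` factors through the finite-valued map sending `J` to its set of ground states.
theorem measurable_relSpin (u v : V) : Measurable (relSpin G u v) := by
  classical
  let chosenSpin (A : Set (SpinConfig V)) : ℝ :=
    if h : A.Nonempty then ((h.choose u * h.choose v : ℤˣ) : ℤ) else 0
  have hfactor : relSpin G u v = fun J => chosenSpin {σ | IsGroundState G J σ} :=
    funext fun J => by
      have hne : {σ | IsGroundState G J σ}.Nonempty := exists_isGroundState G J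
      simp only [chosenSpin, dif_pos hne]
      rfl
  have hhamiltonian (σ : SpinConfig V) : Measurable fun J => hamiltonian G J σ := by
    unfold hamiltonian
    fun_prop
  have hset : Measurable fun J => {σ | IsGroundState G J σ} :=
    measurable_set_iff.2 fun σ => Measurable.forall fun τ =>
      measurableSet_setOfPred.1 (measurableSet_le (hhamiltonian τ) (hhamiltonian σ))
  rw [hfactor]
  exact (Measurable.of_discrete (f := chosenSpin)).comp hset

theorem memLp_relSpin (u v : V) : MemLp (relSpin G u v) 2 (couplingLaw G) := by
  refine MemLp.of_bound (measurable_relSpin G u v).aestronglyMeasurable 1 (ae_of_all _ fun J => ?_)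
  rw [relSpin, Real.norm_eq_abs, ← Int.cast_abs, Int.abs_eq_natAbs, Int.units_natAbs,
    Nat.cast_one, Int.cast_one]

theorem summable_sq_fourierCoeff (u v : V) :
    Summable fun k => fourierCoeff G u v k ^ 2 := by
  have hrel : MemLp (relSpin G u v) 2 (Measure.pi fun _ => γ) := memLp_relSpin G u v
  have hbessel := (orthonormal_toLp_fintype_prod (fun _ => memLp_hermiteFn)
    fun _ : G.edgeSet => orthonormal_hermiteFn).inner_products_summable (hrel.toLp _)
  refine hbessel.congr fun k => ?_
  rw [real_inner_comm, inner_toLp, Real.norm_eq_abs, sq_abs]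
  rfl

theorem sum_spectralMass_eq_tsum (u v : V) (𝒮 : Finset (Finset G.edgeSet)) :
    ∑ S ∈ 𝒮, spectralMass G u v S
      = ∑' k : {k | multiSupport G k ∈ 𝒮}, fourierCoeff G u v k ^ 2 := by
  have hunion : {k | multiSupport G k ∈ 𝒮} = ⋃ S ∈ 𝒮, {k | multiSupport G k = S} := by
    ext k
    simp only [Set.mem_ofPred_eq, Set.mem_iUnion, exists_prop, exists_eq_right']
  have hdisjoint : (𝒮 : Set (Finset G.edgeSet)).PairwiseDisjoint
      fun S => {k | multiSupport G k = S} := fun S _ S' _ hne =>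
    Set.disjoint_left.2 fun k hk hk' => hne (hk.symm.trans hk')
  rw [hunion]
  exact (hasSum_sum_disjoint 𝒮 hdisjoint fun S _ =>
    ((summable_sq_fourierCoeff G u v).subtype _).hasSum).tsum_eq.symm

variable {G} [DecidableEq G.edgeSet]

-- Centring in `A` and independence of the edges off `B` confine the expansion to `A ⊆ S ⊆ B`.
theorem sq_integral_relSpin_mul_prod_le {A B : Finset G.edgeSet} {f : G.edgeSet → ℝ → ℝ}
    (hf : ∀ e, MemLp (f e) 2 γ) (hA : ∀ e ∈ A, ∫ x, f e x ∂γ = 0)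
    (hB : ∀ e ∉ B, ∀ x, f e x = 1) (u v : V) :
    (∫ J, relSpin G u v J * ∏ e, f e (J e) ∂couplingLaw G) ^ 2 ≤
      (∏ e, ∫ x, f e x ^ 2 ∂γ) * ∑ S ∈ Finset.Icc A B, spectralMass G u v S := by
  rw [sum_spectralMass_eq_tsum]
  refine sq_integral_mul_fintype_prod_le (fun _ => memLp_hermiteFn) hf
    (fun _ => orthonormal_hermiteFn) (fun e => hasSum_sq_integral_hermiteFn_mul (hf e))
    (fun k hk => ?_) (memLp_relSpin G u v)
  simp only [Set.mem_ofPred_eq, Finset.mem_Icc, not_and_or,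
    Finset.not_subset, multiSupport, Finset.mem_filter_univ] at hk
  rcases hk with ⟨e, heA, hke⟩ | ⟨e, hke, heB⟩ <;> refine ⟨e, ?_⟩
  · simp_rw [Nat.lt_one_iff.1 (not_le.1 hke), hermiteFn_zero, one_mul]
    exact hA e heA
  · have horth := integral_hermiteFn_mul_hermiteFn (k e) 0
    rw [if_neg (Nat.one_le_iff_ne_zero.1 hke)] at horth
    simpa only [hB e heB, hermiteFn_zero] using horth

end SpectralMass

section Cuts

variable {V : Type*} {σ : SpinConfig V}

theorem sq_edgeSpin (σ : SpinConfig V) (e : Sym2 V) : edgeSpin σ e ^ 2 = 1 := by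
  induction e with
  | _ x y =>
    rw [edgeSpin, Sym2.lift_mk, ← Int.cast_pow, ← Units.val_pow_eq_pow_val, Int.units_sq,
      Units.val_one, Int.cast_one]

theorem abs_edgeSpin (σ : SpinConfig V) (e : Sym2 V) : |edgeSpin σ e| = 1 := by
  rw [← sq_eq_sq₀ (abs_nonneg _) zero_le_one, sq_abs, sq_edgeSpin, one_pow]

variable (G : SimpleGraph V) [Fintype G.edgeSet]

open Classical in
/-- The cut `∂A`: the edges with exactly one end in `A`. -/
def edgeBoundary (A : Set V) : Finset G.edgeSet :=
  Finset.univ.filter fun e => ∃ x ∈ A, ∃ y ∉ A, e.1 = s(x, y)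

variable {G} {A : Set V}

theorem mk_mem_edgeBoundary {x y : V} (h : s(x, y) ∈ G.edgeSet) :
    ⟨s(x, y), h⟩ ∈ edgeBoundary G A ↔ ¬(x ∈ A ↔ y ∈ A) := by
  simp only [edgeBoundary, Finset.mem_filter_univ, Sym2.eq_iff]
  grind

open Classical in
theorem edgeSpin_piecewise_neg (σ : SpinConfig V) (e : G.edgeSet) :
    edgeSpin (A.piecewise (-σ) σ) e
      = if e ∈ edgeBoundary G A then -edgeSpin σ e else edgeSpin σ e := by
  obtain ⟨⟨x, y⟩, h⟩ := e
  by_cases hx : x ∈ A <;> by_cases hy : y ∈ A <;>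
    simp [mk_mem_edgeBoundary, edgeSpin, Set.piecewise, hx, hy]

variable {J : Coupling G}

theorem IsGroundState.sum_edgeBoundary_nonneg (hσ : IsGroundState G J σ) (A : Set V) :
    0 ≤ ∑ e ∈ edgeBoundary G A, J e * edgeSpin σ e := by
  classical
  have hflip : hamiltonian G J (A.piecewise (-σ) σ)
      = hamiltonian G J σ - 2 * ∑ e ∈ edgeBoundary G A, J e * edgeSpin σ e := by
    rw [Finset.mul_sum, ← Finset.univ_inter (edgeBoundary G A), ← Finset.sum_ite_mem,
      hamiltonian, hamiltonian, ← Finset.sum_sub_distrib]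
    refine Finset.sum_congr rfl fun e _ => ?_
    rw [edgeSpin_piecewise_neg]
    split_ifs <;> ring
  have hmax := hσ (A.piecewise (-σ) σ)
  linarith

theorem IsGroundState.pos_of_dominant [DecidableEq G.edgeSet] (hσ : IsGroundState G J σ)
    {e : G.edgeSet} (he : e ∈ edgeBoundary G A)
    (hdom : ∑ e' ∈ (edgeBoundary G A).erase e, |J e'| < |J e|) : 0 < J e * edgeSpin σ e := by
  have habs (e' : G.edgeSet) : |J e' * edgeSpin σ e'| = |J e'| := by
    rw [abs_mul, abs_edgeSpin, mul_one]
  have hrest : ∑ e' ∈ (edgeBoundary G A).erase e, J e' * edgeSpin σ e' < |J e * edgeSpin σ e| :=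
    calc ∑ e' ∈ (edgeBoundary G A).erase e, J e' * edgeSpin σ e'
      _ ≤ ∑ e' ∈ (edgeBoundary G A).erase e, |J e'| :=
        Finset.sum_le_sum fun e' _ => (le_abs_self _).trans_eq (habs e')
      _ < |J e * edgeSpin σ e| := hdom.trans_eq (habs e).symm
  have hcut := hσ.sum_edgeBoundary_nonneg A
  rw [← Finset.add_sum_erase _ _ he] at hcut
  by_contra! hneg
  rw [abs_of_nonpos hneg] at hrest
  linarith

theorem isGroundState_groundState [Finite V] (J : Coupling G) :
    IsGroundState G J (groundState G J) :=
  (exists_isGroundState G J).choose_spec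

end Cuts

section TestFunction

/-- The sign of `x`, cut off to zero where `|x| ≤ 1`: the factor of the test function at the edges
along which the sign of the coupling is to be read off. -/
def largeSign : ℝ → ℝ :=
  Set.indicator {x | 1 < |x|} fun x => x / |x|

theorem measurableSet_one_lt_abs : MeasurableSet {x : ℝ | 1 < |x|} :=
  measurableSet_lt measurable_const measurable_id.abs

theorem sq_largeSign (x : ℝ) : largeSign x ^ 2 = Set.indicator {x | 1 < |x|} 1 x := by
  by_cases hx : x ∈ {x : ℝ | 1 < |x|}
  · have hx0 : |x| ≠ 0 := (zero_lt_one.trans hx).ne'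
    rw [largeSign, Set.indicator_of_mem hx, Set.indicator_of_mem hx, div_pow, ← sq_abs x,
      div_self (pow_ne_zero 2 hx0), Pi.one_apply]
  · rw [largeSign, Set.indicator_of_notMem hx, Set.indicator_of_notMem hx, sq, mul_zero]

theorem mul_largeSign {s x : ℝ} (hs : |s| = 1) (hpos : 1 < |x| → 0 < x * s) :
    s * largeSign x = largeSign x ^ 2 := by
  rw [sq_largeSign]
  by_cases hx : x ∈ {x : ℝ | 1 < |x|}
  · have habs : |x| = x * s := by rw [← abs_of_pos (hpos hx), abs_mul, hs, mul_one]
    rw [largeSign, Set.indicator_of_mem hx, Set.indicator_of_mem hx, Pi.one_apply, habs,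
      mul_div_assoc', mul_comm s, div_self (hpos hx).ne']
  · rw [largeSign, Set.indicator_of_notMem hx, Set.indicator_of_notMem hx, mul_zero]

theorem memLp_largeSign : MemLp largeSign 2 γ := by
  refine MemLp.of_bound (Measurable.aestronglyMeasurable ?_) 1 (ae_of_all _ fun x => ?_)
  · exact (measurable_id.div measurable_id.abs).indicator measurableSet_one_lt_abs
  · rw [Real.norm_eq_abs, ← sq_le_one_iff_abs_le_one, sq_largeSign]
    exact Set.indicator_le_self' (f := 1) (fun _ _ => zero_le_one) x

theorem integral_largeSign : ∫ x, largeSign x ∂γ = 0 := by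
  have hodd (x : ℝ) : largeSign (-x) = -largeSign x := by
    simp only [largeSign, Set.indicator_apply, Set.mem_ofPred_eq, abs_neg, neg_div]
    split_ifs <;> simp only [neg_zero]
  have hsymm : ∫ x, largeSign (-x) ∂γ = ∫ x, largeSign x ∂γ := by
    conv_rhs => rw [← neg_zero (G := ℝ), ← gaussianReal_map_neg]
    exact (integral_map measurable_neg.aemeasurable
      (by rw [gaussianReal_map_neg, neg_zero]; exact memLp_largeSign.1)).symm
  simp_rw [hodd, integral_neg] at hsymm
  linarith

theorem integral_sq_largeSign : ∫ x, largeSign x ^ 2 ∂γ = (γ).real {x | 1 < |x|} := by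
  simp_rw [sq_largeSign]
  exact integral_indicator_one measurableSet_one_lt_abs

variable {E : Type*} [DecidableEq E]

/-- The factor at the edge `e` of the test function: on `L` the cut-off sign of the coupling, on
`B \ L` the indicator that the coupling is at most `ε` in absolute value, elsewhere `1`. -/
def testFactor (L B : Finset E) (ε : ℝ) (e : E) : ℝ → ℝ :=
  if e ∈ L then largeSign else if e ∈ B then Set.indicator (Set.Icc (-ε) ε) 1 else 1

variable {L B : Finset E} {ε : ℝ} {e : E}

theorem testFactor_of_mem (he : e ∈ L) : testFactor L B ε e = largeSign :=
  if_pos he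

theorem testFactor_of_mem_sdiff (he : e ∈ B \ L) :
    testFactor L B ε e = Set.indicator (Set.Icc (-ε) ε) 1 := by
  rw [testFactor, if_neg (Finset.mem_sdiff.1 he).2, if_pos (Finset.mem_sdiff.1 he).1]

theorem testFactor_of_notMem (hLB : L ⊆ B) (he : e ∉ B) : testFactor L B ε e = 1 := by
  rw [testFactor, if_neg (mt (@hLB e) he), if_neg he]

theorem sq_testFactor_of_notMem (he : e ∉ L) (x : ℝ) :
    testFactor L B ε e x ^ 2 = testFactor L B ε e x := by
  rw [testFactor, if_neg he]
  split_ifs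
  · by_cases hx : x ∈ Set.Icc (-ε) ε
    · rw [Set.indicator_of_mem hx, Pi.one_apply, one_pow]
    · rw [Set.indicator_of_notMem hx, sq, mul_zero]
  · rw [Pi.one_apply, one_pow]

theorem abs_le_of_testFactor_ne_zero {x : ℝ} (he : e ∈ B \ L) (h : testFactor L B ε e x ≠ 0) :
    |x| ≤ ε := by
  rw [testFactor_of_mem_sdiff he] at h
  have hx : x ∈ Set.Icc (-ε) ε := Set.mem_of_indicator_ne_zero h
  exact abs_le.2 hx

theorem memLp_testFactor (L B : Finset E) (ε : ℝ) (e : E) : MemLp (testFactor L B ε e) 2 γ := by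
  unfold testFactor
  split_ifs
  · exact memLp_largeSign
  · exact (memLp_const (1 : ℝ)).indicator measurableSet_Icc
  · exact memLp_const (1 : ℝ)

theorem prod_integral_sq_testFactor [Fintype E] (hLB : L ⊆ B) :
    ∏ e, ∫ x, testFactor L B ε e x ^ 2 ∂γ
      = (γ).real {x | 1 < |x|} ^ #L * (γ).real (Set.Icc (-ε) ε) ^ #(B \ L) := by
  have hoff (e : E) (he : e ∉ B) : ∫ x, testFactor L B ε e x ^ 2 ∂γ = 1 := by
    simp_rw [testFactor_of_notMem hLB he, Pi.one_apply, one_pow, integral_const, probReal_univ,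
      one_smul]
  have hsmall (e : E) (he : e ∈ B \ L) :
      ∫ x, testFactor L B ε e x ^ 2 ∂γ = (γ).real (Set.Icc (-ε) ε) := by
    simp_rw [sq_testFactor_of_notMem (Finset.mem_sdiff.1 he).2, testFactor_of_mem_sdiff he]
    exact integral_indicator_one measurableSet_Icc
  have hlarge (e : E) (he : e ∈ L) : ∫ x, testFactor L B ε e x ^ 2 ∂γ = (γ).real {x | 1 < |x|} := by
    simp_rw [testFactor_of_mem he, integral_sq_largeSign]
  rw [← Finset.prod_subset (Finset.subset_univ B) fun e _ he => hoff e he,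
    ← Finset.prod_sdiff hLB, Finset.prod_congr rfl hsmall, Finset.prod_congr rfl hlarge,
    Finset.prod_const, Finset.prod_const, mul_comm]

end TestFunction

section ShieldedChain

variable {V : Type*} {G : SimpleGraph V} [Fintype G.edgeSet] [DecidableEq G.edgeSet]

/-- A chain `L` of edges from `u` to `v`, shielded by a larger set `B`. Its boundary modulo 2 is
`{u, v}`, which is expressed by the spins along `L` multiplying to `σ_u σ_v`, and each edge of `L`
lies in a cut whose other edges all belong to `B \ L`. -/
structure IsShieldedChain (u v : V) (L B : Finset G.edgeSet) : Prop where
  subset : L ⊆ B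
  prod_edgeSpin : ∀ σ : SpinConfig V, ∏ e ∈ L, edgeSpin σ e = ((σ u * σ v : ℤˣ) : ℤ)
  exists_cut : ∀ e ∈ L, ∃ A, e ∈ edgeBoundary G A ∧ (edgeBoundary G A).erase e ⊆ B \ L

variable {u v : V} {L B : Finset G.edgeSet} {ε : ℝ}

theorem IsGroundState.pos_of_mem_chain {J : Coupling G} {σ : SpinConfig V}
    (hσ : IsGroundState G J σ) (hchain : IsShieldedChain u v L B) (hε : #(B \ L) * ε ≤ 1)
    (hsmall : ∀ e ∈ B \ L, |J e| ≤ ε) {e : G.edgeSet} (he : e ∈ L) (hlarge : 1 < |J e|) :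
    0 < J e * edgeSpin σ e := by
  obtain ⟨A, heA, hA⟩ := hchain.exists_cut e he
  refine hσ.pos_of_dominant heA ?_
  calc ∑ e' ∈ (edgeBoundary G A).erase e, |J e'|
    _ ≤ ∑ e' ∈ B \ L, |J e'| := Finset.sum_le_sum_of_subset_of_nonneg hA fun _ _ _ => abs_nonneg _
    _ ≤ #(B \ L) • ε := Finset.sum_le_card_nsmul _ _ _ hsmall
    _ ≤ 1 := by rwa [nsmul_eq_mul]
    _ < |J e| := hlarge

namespace IsShieldedChain

variable [Finite V] (hchain : IsShieldedChain u v L B) (hε : #(B \ L) * ε ≤ 1)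
include hchain hε

theorem relSpin_mul_prod_testFactor (J : Coupling G) :
    relSpin G u v J * ∏ e, testFactor L B ε e (J e) = ∏ e, testFactor L B ε e (J e) ^ 2 := by
  by_cases hzero : ∃ e, testFactor L B ε e (J e) = 0
  · obtain ⟨e, he⟩ := hzero
    rw [Finset.prod_pow, Finset.prod_eq_zero (Finset.mem_univ e) he, sq, zero_mul, mul_zero]
  push Not at hzero
  rw [relSpin, ← hchain.prod_edgeSpin, ← Fintype.prod_ite_mem, ← Finset.prod_mul_distrib]
  refine Finset.prod_congr rfl fun e _ => ?_
  by_cases he : e ∈ L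
  · rw [if_pos he, testFactor_of_mem he]
    exact mul_largeSign (abs_edgeSpin _ _) ((isGroundState_groundState J).pos_of_mem_chain hchain hε
      (fun e he => abs_le_of_testFactor_ne_zero he (hzero e)) he)
  · rw [if_neg he, one_mul, sq_testFactor_of_notMem he]

theorem le_sum_spectralMass :
    (γ).real {x | 1 < |x|} ^ #L * (γ).real (Set.Icc (-ε) ε) ^ #(B \ L)
      ≤ ∑ S ∈ Finset.Icc L B, spectralMass G u v S := by
  have hmass : 0 ≤ ∑ S ∈ Finset.Icc L B, spectralMass G u v S :=
    Finset.sum_nonneg fun S _ => tsum_nonneg fun k => sq_nonneg _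
  have hcorr := sq_integral_relSpin_mul_prod_le (memLp_testFactor L B ε)
    (fun e he => by rw [testFactor_of_mem he, integral_largeSign])
    (fun e he => by rw [testFactor_of_notMem hchain.subset he]; exact fun _ => rfl) u v
  simp_rw [hchain.relSpin_mul_prod_testFactor hε] at hcorr
  rw [couplingLaw, integral_fintype_prod_eq_prod fun e x => testFactor L B ε e x ^ 2,
    prod_integral_sq_testFactor hchain.subset, sq] at hcorr
  by_contra! hlt
  exact hcorr.not_gt (mul_lt_mul_of_pos_left hlt (hmass.trans_lt hlt))

theorem exists_le_spectralMass :
    ∃ S ∈ Finset.Icc L B,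
      (γ).real {x | 1 < |x|} ^ #L * ((γ).real (Set.Icc (-ε) ε) / 2) ^ #(B \ L)
        ≤ spectralMass G u v S := by
  refine Finset.exists_le_of_sum_le (Finset.nonempty_Icc.2 hchain.subset) ?_
  refine le_trans (le_of_eq ?_) (hchain.le_sum_spectralMass hε)
  rw [Finset.sum_const, Finset.card_Icc_finset hchain.subset,
    ← Finset.card_sdiff_of_subset hchain.subset, nsmul_eq_mul, div_pow]
  push_cast
  field_simp

end IsShieldedChain

end ShieldedChain

section GaussianEstimates

theorem mul_gaussianPDFReal_le_real_Icc {ε : ℝ} (h0 : 0 ≤ ε) (h1 : ε ≤ 1) :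
    2 * ε * gaussianPDFReal 0 1 1 ≤ (γ).real (Set.Icc (-ε) ε) := by
  have hpdf (x : ℝ) (hx : x ∈ Set.Icc (-ε) ε) :
      gaussianPDFReal 0 1 1 ≤ gaussianPDFReal 0 1 x := by
    have hsq : x ^ 2 ≤ 1 := (sq_le_one_iff_abs_le_one x).2 ((abs_le.2 hx).trans h1)
    simp only [gaussianPDFReal, sub_zero, one_pow]
    gcongr
  have hint := setIntegral_ge_of_const_le_real measurableSet_Icc measure_Icc_lt_top.ne hpdf
    (integrable_gaussianPDFReal 0 1).integrableOn
  rwa [Real.volume_real_Icc_of_le (neg_le_self h0), sub_neg_eq_add, ← two_mul, mul_comm,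
    ← ENNReal.toReal_ofReal (setIntegral_nonneg measurableSet_Icc fun x _ =>
      gaussianPDFReal_nonneg 0 1 x), ← gaussianReal_apply_eq_integral 0 one_ne_zero] at hint

theorem real_one_lt_abs_pos : 0 < (γ).real {x | 1 < |x|} := by
  have hopen : IsOpen {x : ℝ | 1 < |x|} := isOpen_lt continuous_const continuous_abs
  have hvol := hopen.measure_pos volume ⟨2, by norm_num⟩
  exact ENNReal.toReal_pos
    (fun h => hvol.ne' (gaussianReal_absolutelyContinuous' 0 one_ne_zero h)) (measure_ne_top _ _)

theorem exists_div_pow_le_real_pow_mul_pow :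
    ∃ δ : ℝ, 0 < δ ∧ ∀ N a b : ℕ, N ≠ 0 → a + b ≤ N → (δ / N) ^ N ≤
      (γ).real {x | 1 < |x|} ^ a * ((γ).real (Set.Icc (-(1 / N : ℝ)) (1 / N)) / 2) ^ b := by
  set δ := min ((γ).real {x | 1 < |x|}) (gaussianPDFReal 0 1 1)
  have hδ0 : 0 < δ := lt_min real_one_lt_abs_pos (gaussianPDFReal_pos 0 1 1 one_ne_zero)
  refine ⟨δ, hδ0, fun N a b hN hab => ?_⟩
  have hN1 : (1 : ℝ) ≤ N := Nat.one_le_cast.2 (Nat.one_le_iff_ne_zero.2 hN)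
  have hlarge : δ / N ≤ (γ).real {x | 1 < |x|} := (div_le_self hδ0.le hN1).trans (min_le_left _ _)
  have hsmall : δ / N ≤ (γ).real (Set.Icc (-(1 / N : ℝ)) (1 / N)) / 2 :=
    calc δ / N
      _ ≤ gaussianPDFReal 0 1 1 / N := by gcongr; exact min_le_right _ _
      _ = 2 * (1 / N) * gaussianPDFReal 0 1 1 / 2 := by ring
      _ ≤ _ := by
        gcongr
        exact mul_gaussianPDFReal_le_real_Icc (by positivity)
          (div_le_one_of_le₀ hN1 (by positivity))
  calc (δ / N) ^ N
    _ ≤ (δ / N) ^ (a + b) :=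
      pow_le_pow_of_le_one (by positivity) (hlarge.trans measureReal_le_one) hab
    _ = (δ / N) ^ a * (δ / N) ^ b := pow_add _ _ _
    _ ≤ _ := by gcongr

theorem exists_exp_neg_mul_log_le_div_pow {δ : ℝ} (hδ : 0 < δ) (m : ℕ) :
    ∃ c : ℝ, 0 < c ∧ ∀ n : ℕ, 2 ≤ n → Real.exp (-c * n * Real.log n) ≤ (δ / n) ^ (m * n) := by
  have hlog2 : 0 < Real.log 2 := Real.log_pos one_lt_two
  refine ⟨1 + m * (1 + |Real.log δ| / Real.log 2), by positivity, fun n hn => ?_⟩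
  have hn0 : (0 : ℝ) < n := by positivity
  have hlog : Real.log 2 ≤ Real.log n := Real.log_le_log two_pos (Nat.ofNat_le_cast.2 hn)
  have hδn : -Real.log δ ≤ |Real.log δ| / Real.log 2 * Real.log n := by
    rw [div_mul_eq_mul_div, le_div_iff₀ hlog2]
    exact mul_le_mul (neg_le_abs _) hlog hlog2.le (abs_nonneg _)
  rw [← Real.le_log_iff_exp_le (by positivity), Real.log_pow, Real.log_div hδ.ne' hn0.ne',
    Nat.cast_mul]
  have hmn := mul_le_mul_of_nonneg_left hδn (by positivity : (0 : ℝ) ≤ m * n)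
  have hlogn := mul_nonneg hn0.le (hlog2.le.trans hlog)
  linarith

theorem exists_exp_neg_mul_log_le_real_pow_mul_pow {m : ℕ} (hm : m ≠ 0) :
    ∃ c : ℝ, 0 < c ∧ ∀ n a b : ℕ, 2 ≤ n → a + b ≤ m * n → Real.exp (-c * n * Real.log n) ≤
      (γ).real {x | 1 < |x|} ^ a *
        ((γ).real (Set.Icc (-(1 / (m * n : ℕ) : ℝ)) (1 / (m * n : ℕ))) / 2) ^ b := by
  obtain ⟨δ, hδ, hgauss⟩ := exists_div_pow_le_real_pow_mul_pow
  obtain ⟨c, hc, hexp⟩ := exists_exp_neg_mul_log_le_div_pow (δ := δ / m) (by positivity) m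
  refine ⟨c, hc, fun n a b hn hab => (hexp n hn).trans ?_⟩
  rw [div_div, ← Nat.cast_mul]
  exact hgauss (m * n) a b (by positivity) hab

end GaussianEstimates

section GridGeometry

theorem prod_edgeSpin_range {V : Type*} (σ : SpinConfig V) (w : ℕ → V) (m : ℕ) :
    ∏ k ∈ Finset.range m, edgeSpin σ s(w k, w (k + 1)) = ((σ (w 0) * σ (w m) : ℤˣ) : ℤ) := by
  rw [← Int.units_div_eq_mul, ← Finset.prod_range_div' (fun k => σ (w k))]
  simp_rw [Int.units_div_eq_mul, Units.coe_prod, Int.cast_prod]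
  rfl

variable {n : ℕ}

/-- The four nearest neighbours of the origin in `ℤ²`. -/
def unitSteps : Finset (ℤ × ℤ) :=
  {(1, 0), (-1, 0), (0, 1), (0, -1)}

theorem mem_unitSteps {a b : ℤ} (h : |a| + |b| = 1) : (a, b) ∈ unitSteps := by
  simp only [unitSteps, Finset.mem_insert, Finset.mem_singleton, Prod.mk.injEq]
  rcases abs_cases a with ha | ha <;> rcases abs_cases b with hb | hb <;> omega

theorem map_val_injective :
    Function.Injective fun e : (grid n).edgeSet => Sym2.map Subtype.val e.1 :=
  (Sym2.map.injective Subtype.val_injective).comp Subtype.val_injective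

open Classical in
theorem card_filter_mem_le_four (w : GridVertex n) :
    #{e : (grid n).edgeSet | w ∈ e.1} ≤ 4 := by
  refine (Finset.card_le_card_of_injOn (t := unitSteps.image fun d => s(w.1, w.1 + d)) _
    (fun e he => ?_) map_val_injective.injOn).trans Finset.card_image_le
  obtain ⟨y, hy⟩ := (Finset.mem_filter_univ e).1 he
  have hadj : |w.1.1 - y.1.1| + |w.1.2 - y.1.2| = 1 := (grid n).mem_edgeSet.1 (hy ▸ e.2)
  rw [abs_sub_comm w.1.1, abs_sub_comm w.1.2] at hadj
  refine Finset.mem_coe.2 (Finset.mem_image.2 ⟨y.1 - w.1, mem_unitSteps hadj, ?_⟩)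
  rw [add_sub_cancel, hy, Sym2.map_mk]

/-- The vertices of the row of `line n`, counted from the left end (and from `n - 1` on, the right
end). -/
def rowVertex (hn : 2 ≤ n) (k : ℕ) : GridVertex n :=
  ⟨(min (k + 1 : ℤ) n, (n : ℤ) / 2), by simp only [Finset.mem_product, Finset.mem_Icc]; omega⟩

theorem val_rowVertex (hn : 2 ≤ n) {k : ℕ} (hk : k < n) :
    (rowVertex hn k).1 = ((k : ℤ) + 1, (n : ℤ) / 2) :=
  Prod.ext (min_eq_left (by omega)) rfl

theorem rowVertex_zero (hn : 2 ≤ n) : rowVertex hn 0 = leftEnd n hn := by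
  refine Subtype.ext (Prod.ext ?_ rfl)
  simp only [rowVertex, leftEnd]
  omega

theorem rowVertex_sub_one (hn : 2 ≤ n) : rowVertex hn (n - 1) = rightEnd n hn := by
  refine Subtype.ext (Prod.ext ?_ rfl)
  simp only [rowVertex, rightEnd]
  omega

theorem exists_rowVertex_eq (hn : 2 ≤ n) {w : GridVertex n} (hw : w.1.2 = (n : ℤ) / 2) :
    ∃ k < n, rowVertex hn k = w := by
  have hmem := w.2
  simp only [Finset.mem_product, Finset.mem_Icc] at hmem
  refine ⟨(w.1.1 - 1).toNat, by omega, Subtype.ext (Prod.ext ?_ hw.symm)⟩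
  simp only [rowVertex]
  omega

/-- The edges of `line n`, counted from the left end. -/
def rowEdge (hn : 2 ≤ n) (k : Fin (n - 1)) : (grid n).edgeSet :=
  ⟨s(rowVertex hn k, rowVertex hn (k + 1)), by
    rw [SimpleGraph.mem_edgeSet]
    simp only [grid, val_rowVertex hn (show (k : ℕ) < n by omega),
      val_rowVertex hn (show (k : ℕ) + 1 < n by omega)]
    grind⟩

theorem map_val_rowEdge (hn : 2 ≤ n) (k : Fin (n - 1)) : Sym2.map Subtype.val (rowEdge hn k).1
    = s(((k : ℤ) + 1, (n : ℤ) / 2), ((k : ℤ) + 1 + 1, (n : ℤ) / 2)) := by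
  rw [rowEdge, Sym2.map_mk, val_rowVertex hn (by omega), val_rowVertex hn (by omega), Nat.cast_succ]

theorem rowEdge_injective (hn : 2 ≤ n) : Function.Injective (rowEdge hn) := by
  intro j k hjk
  have hmap := map_val_rowEdge hn j
  rw [hjk, map_val_rowEdge] at hmap
  simp only [Sym2.eq_iff, Prod.mk.injEq] at hmap
  exact Fin.ext (by omega)

theorem mem_line_iff (hn : 2 ≤ n) {e : (grid n).edgeSet} : e ∈ line n ↔ ∃ k, rowEdge hn k = e := by
  simp only [line, Finset.mem_filter_univ]
  constructor
  · rintro ⟨k, hk1, hkn, he⟩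
    refine ⟨⟨(k - 1).toNat, by omega⟩, map_val_injective ?_⟩
    simp only [map_val_rowEdge, he, Int.toNat_of_nonneg (sub_nonneg.2 hk1), sub_add_cancel]
  · rintro ⟨k, rfl⟩
    exact ⟨k + 1, by omega, by omega, map_val_rowEdge hn k⟩

theorem prod_edgeSpin_line (hn : 2 ≤ n) (σ : SpinConfig (GridVertex n)) :
    ∏ e ∈ line n, edgeSpin σ e = ((σ (leftEnd n hn) * σ (rightEnd n hn) : ℤˣ) : ℤ) := by
  classical
  have himage : line n = Finset.univ.image (rowEdge hn) := by
    ext e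
    rw [mem_line_iff hn, mem_image_univ_iff_mem_range, Set.mem_range]
  rw [himage, Finset.prod_image (rowEdge_injective hn).injOn, ← rowVertex_zero,
    ← rowVertex_sub_one, ← prod_edgeSpin_range]
  exact Fin.prod_univ_eq_prod_range
    (fun k => edgeSpin σ s(rowVertex hn k, rowVertex hn (k + 1))) (n - 1)

theorem line_subset_lineHat : line n ⊆ lineHat n :=
  Finset.subset_union_left

theorem mem_lineHat_iff (hn : 2 ≤ n) {e : (grid n).edgeSet} :
    e ∈ lineHat n ↔ ∃ k < n, rowVertex hn k ∈ e.1 := by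
  have hline (f : (grid n).edgeSet) (hf : f ∈ line n) (w : GridVertex n) (hw : w ∈ f.1) :
      ∃ k < n, rowVertex hn k = w := by
    obtain ⟨k, rfl⟩ := (mem_line_iff hn).1 hf
    rcases Sym2.mem_iff.1 hw with rfl | rfl
    exacts [⟨k, by omega, rfl⟩, ⟨k + 1, by omega, rfl⟩]
  simp only [lineHat, Finset.mem_union, Finset.mem_filter_univ]
  constructor
  · rintro (he | ⟨f, hf, w, hwe, hwf⟩)
    · obtain ⟨k, hk, hke⟩ := hline e he _ (Sym2.out_fst_mem e.1)
      exact ⟨k, hk, hke ▸ Sym2.out_fst_mem e.1⟩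
    · obtain ⟨k, hk, rfl⟩ := hline f hf w hwf
      exact ⟨k, hk, hwe⟩
  · rintro ⟨k, hk, hke⟩
    right
    rcases Nat.lt_or_ge k (n - 1) with hlt | hge
    · exact ⟨rowEdge hn ⟨k, hlt⟩, (mem_line_iff hn).2 ⟨_, rfl⟩, _, hke, Sym2.mem_mk_left _ _⟩
    · obtain rfl : k = n - 2 + 1 := by omega
      exact ⟨rowEdge hn ⟨n - 2, by omega⟩, (mem_line_iff hn).2 ⟨_, rfl⟩, _, hke,
        Sym2.mem_mk_right _ _⟩

theorem card_lineHat_le (hn : 2 ≤ n) : #(lineHat n) ≤ 4 * n := by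
  classical
  have hcover : lineHat n ⊆ (Finset.range n).biUnion
      fun k => {e : (grid n).edgeSet | rowVertex hn k ∈ e.1} := fun e he => by
    simpa only [Finset.mem_biUnion, Finset.mem_range, Finset.mem_filter_univ]
      using (mem_lineHat_iff hn).1 he
  calc #(lineHat n)
    _ ≤ #(Finset.range n) * 4 := (Finset.card_le_card hcover).trans
      (Finset.card_biUnion_le_card_mul _ _ _ fun k _ => card_filter_mem_le_four _)
    _ = 4 * n := by rw [Finset.card_range, mul_comm]

/-- The vertices of the row of `line n` whose first coordinate is at most `a`. -/
def rowSegment (n : ℕ) (a : ℤ) : Set (GridVertex n) :=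
  {x | x.1.1 ≤ a ∧ x.1.2 = (n : ℤ) / 2}

theorem rowEdge_mem_edgeBoundary_iff (hn : 2 ≤ n) {j k : Fin (n - 1)} :
    rowEdge hn j ∈ edgeBoundary (grid n) (rowSegment n (k + 1)) ↔ j = k := by
  rw [rowEdge, mk_mem_edgeBoundary, Fin.ext_iff]
  simp only [rowSegment, Set.mem_ofPred_eq, val_rowVertex hn (show (j : ℕ) < n by omega),
    val_rowVertex hn (show (j : ℕ) + 1 < n by omega), and_true]
  omega

theorem edgeBoundary_rowSegment_subset (hn : 2 ≤ n) (a : ℤ) :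
    edgeBoundary (grid n) (rowSegment n a) ⊆ lineHat n := by
  intro e he
  simp only [edgeBoundary, Finset.mem_filter_univ] at he
  obtain ⟨x, ⟨-, hx⟩, y, -, hxy⟩ := he
  obtain ⟨k, hk, rfl⟩ := exists_rowVertex_eq hn hx
  exact (mem_lineHat_iff hn).2 ⟨k, hk, hxy ▸ Sym2.mem_mk_left _ _⟩

theorem isShieldedChain_line [DecidableEq (grid n).edgeSet] (hn : 2 ≤ n) :
    IsShieldedChain (leftEnd n hn) (rightEnd n hn) (line n) (lineHat n) where
  subset := line_subset_lineHat
  prod_edgeSpin := prod_edgeSpin_line hn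
  exists_cut e he := by
    obtain ⟨k, rfl⟩ := (mem_line_iff hn).1 he
    refine ⟨rowSegment n (k + 1), (rowEdge_mem_edgeBoundary_iff hn).2 rfl, fun e he => ?_⟩
    obtain ⟨hne, he⟩ := Finset.mem_erase.1 he
    refine Finset.mem_sdiff.2 ⟨edgeBoundary_rowSegment_subset hn _ he, fun hline => hne ?_⟩
    obtain ⟨j, rfl⟩ := (mem_line_iff hn).1 hline
    rw [(rowEdge_mem_edgeBoundary_iff hn).1 he]

end GridGeometry

end EdwardsAnderson

end

open Classical in
theorem mainTheorem3_general :
    ∃ c : ℝ, 0 < c ∧ ∀ (n : ℕ) (hn : 2 ≤ n),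
      Real.exp (-c * n * Real.log n) ≤
          (∑ S : Finset (EdwardsAnderson.grid n).edgeSet with
            EdwardsAnderson.line n ⊆ S ∧ S ⊆ EdwardsAnderson.lineHat n,
            EdwardsAnderson.spectralMass (EdwardsAnderson.grid n)
              (EdwardsAnderson.leftEnd n hn) (EdwardsAnderson.rightEnd n hn) S) ∧
        ∃ S : Finset (EdwardsAnderson.grid n).edgeSet,
          EdwardsAnderson.line n ⊆ S ∧ S ⊆ EdwardsAnderson.lineHat n ∧
          Real.exp (-c * n * Real.log n) ≤
            EdwardsAnderson.spectralMass (EdwardsAnderson.grid n)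
              (EdwardsAnderson.leftEnd n hn) (EdwardsAnderson.rightEnd n hn) S := by
  obtain ⟨c, hc, hbound⟩ :=
    EdwardsAnderson.exists_exp_neg_mul_log_le_real_pow_mul_pow four_ne_zero
  refine ⟨c, hc, fun n hn => ?_⟩
  have hchain := EdwardsAnderson.isShieldedChain_line hn
  set L := EdwardsAnderson.line n
  set B := EdwardsAnderson.lineHat n
  have hcard : L.card + (B \ L).card ≤ 4 * n := by
    rw [add_comm, Finset.card_sdiff_add_card_eq_card hchain.subset]
    exact EdwardsAnderson.card_lineHat_le hn
  have hε : (B \ L).card * (1 / (4 * n : ℕ) : ℝ) ≤ 1 := by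
    rw [mul_one_div]
    exact div_le_one_of_le₀ (Nat.cast_le.2 (le_of_add_le_right hcard)) (Nat.cast_nonneg _)
  have hexp := hbound n _ _ hn hcard
  have hIcc : Finset.univ.filter (fun S => L ⊆ S ∧ S ⊆ B) = Finset.Icc L B :=
    Finset.filter_le_le_eq_Icc L B
  rw [hIcc]
  obtain ⟨S, hS, hmass⟩ := hchain.exists_le_spectralMass hε
  refine ⟨?_, S, (Finset.mem_Icc.1 hS).1, (Finset.mem_Icc.1 hS).2, hexp.trans hmass⟩
  refine (hexp.trans ?_).trans (hchain.le_sum_spectralMass hε)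
  gcongr
  exact half_le_self measureReal_nonneg

open Classical in
theorem mainTheorem3 :
    ∃ c : ℝ, 0 < c ∧ ∀ (n : ℕ) (hn : 2 ≤ n), Even n →
      Real.exp (-c * n * Real.log n) ≤
          (∑ S : Finset (EdwardsAnderson.grid n).edgeSet with
            EdwardsAnderson.line n ⊆ S ∧ S ⊆ EdwardsAnderson.lineHat n,
            EdwardsAnderson.spectralMass (EdwardsAnderson.grid n)
              (EdwardsAnderson.leftEnd n hn) (EdwardsAnderson.rightEnd n hn) S) ∧
        ∃ S : Finset (EdwardsAnderson.grid n).edgeSet,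
          EdwardsAnderson.line n ⊆ S ∧ S ⊆ EdwardsAnderson.lineHat n ∧
          Real.exp (-c * n * Real.log n) ≤
            EdwardsAnderson.spectralMass (EdwardsAnderson.grid n)
              (EdwardsAnderson.leftEnd n hn) (EdwardsAnderson.rightEnd n hn) S := by
  obtain ⟨c, hc, hbound⟩ := mainTheorem3_general
  exact ⟨c, hc, fun n hn _ => hbound n hn⟩
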